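/- Let $\{\varphi_n\}$ ($n\in\mathbb N$ or $n\in\mathbb Z$) be an orthonormal system in the complex space $L_2=L_2(0,1)$ with $M:=\sup_n\|\varphi_n\|_{L_\infty}<\infty$ (so that $M\ge 1$). For a measurable function $f$ on $[0,1]$ let $f^*(u)=\inf\{s\ge 0: |\{x\in[0,1]:|f(x)|>s\}|\le u\}$ be its non-increasing rearrangement, and for a family $c=\{c_n\}$ of complex numbers let $c_k^*=\inf\{s\ge 0:\#\{n:|c_n|>s\}\le k-1\}$, $k=1,2,\dots$, be its non-increasing rearrangement. For $0<q\le\infty$ and $\alpha\in\mathbb R$ put $$\|f\|_{L^{\mathcal L}_{2,q,\alpha,2}}=\left(\int_0^1\Big[(1+|\log t|)^\alpha\Big(\int_0^t f^*(u)^2\,du\Big)^{1/2}\Big]^q\frac{dt}{t}\right)^{1/q},$$ $$\|c\|_{l^{\mathcal R}_{2,q,\alpha,2}}=\left(\sum_{k=1}^\infty\Big[(1+\log k)^\alpha\Big(\sum_{i=k}^\infty (c_i^*)^2\Big)^{1/2}\Big]^q\frac1k\right)^{1/q},$$ where for $q=\infty$ the outer integral and the outer sum are replaced by the suprema over $0<t<1$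 and $k\ge1$ of the expressions in square brackets, and $1/q=0$. **Theorem 1.2.** Let $0<q\le\infty$, $\alpha>-1/q$ and $\varepsilon>0$. There is a constant $C$ depending only on $q$, $\alpha$ and $\varepsilon$ such that, for every such system $\{\varphi_n\}$ and every $c$ with $\|c\|_{l^{\mathcal R}_{2,q,\alpha,2}}<\infty$, the series $\sum_n c_n\varphi_n$ converges unconditionally in $L_2$, and its sum $f$ satisfies $$\|f\|_{L^{\mathcal L}_{2,q,\alpha,2}}\le C\,\min\!\left(M,(1+\log M)^{|\alpha|+\varepsilon+1/q}\right)\|c\|_{l^{\mathcal R}_{2,q,\alpha,2}}.$$ Moreover, if $q<\infty$, the series converges to $f$ unconditionally in the quasi-norm of $L^{\mathcal L}_{2,q,\alpha,2}$; if $q=\infty$, the same holds provided that $(1+\log k)^\alpha\big(\sum_{i\ge k}(c_i^*)^2\big)^{1/2}\to0$ as $k\to\infty$. -/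

import Mathlib

open MeasureTheory Filter Topology
open scoped ENNReal NNReal

noncomputable section

namespace LimitingFourier

/-- Lebesgue measure on the unit interval `[0,1]`. -/
abbrev unitMeasure : Measure ℝ := volume.restrict (Set.Icc 0 1)

/-- The non-increasing rearrangement `f*(u) = inf {s ≥ 0 : |{x ∈ [0,1] : |f x| > s}| ≤ u}`
of a function on `[0,1]`. -/
def funRearr (f : ℝ → ℂ) (u : ℝ) : ℝ≥0∞ :=
  sInf {s : ℝ≥0∞ | unitMeasure {x | s < ‖f x‖ₑ} ≤ ENNReal.ofReal u}

/-- The non-increasing rearrangement of a family of complex numbers, numbered from `0`: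
`seqRearr c k` is `c*_{k+1} = inf {s ≥ 0 : #{i : |c i| > s} ≤ k}`. -/
def seqRearr {ι : Type*} (c : ι → ℂ) (k : ℕ) : ℝ≥0∞ :=
  sInf {s : ℝ≥0∞ | {i | s < ‖c i‖ₑ}.encard ≤ (k : ℕ∞)}

/-- The weight `t^{-1/q} (1 + |log t|)^α` for `t > 0`, where `1/∞ = 0`. -/
def weight (q : ℝ≥0∞) (α t : ℝ) : ℝ≥0∞ :=
  ENNReal.ofReal (t ^ (-(q⁻¹).toReal) * (1 + |Real.log t|) ^ α)

/-- The quasi-norm of `L^L_{2,q,α,2}`, that is, the `L_q(0,1)` quasi-norm of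
`t ↦ t^{-1/q} (1 + |log t|)^α (∫_0^t f*(u)^2 du)^{1/2}`. -/
def normLL (q : ℝ≥0∞) (α : ℝ) (f : ℝ → ℂ) : ℝ≥0∞ :=
  eLpNorm
    (fun t : ℝ => weight q α t * (∫⁻ u in Set.Ioo 0 t, funRearr f u ^ 2) ^ (1 / 2 : ℝ))
    q (volume.restrict (Set.Ioo 0 1))

/-- With `m = k + 1`, the number
`m^{-1/q} (1 + log m)^α (∑_{i ≥ m} (c*_i)^2)^{1/2}`. -/
def tailTerm {ι : Type*} (q : ℝ≥0∞) (α : ℝ) (c : ι → ℂ) (k : ℕ) : ℝ≥0∞ :=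
  weight q α ((k : ℝ) + 1) * (∑' i : ℕ, seqRearr c (k + i) ^ 2) ^ (1 / 2 : ℝ)

/-- The quasi-norm of `l^R_{2,q,α,2}`, that is, the `l_q` quasi-norm of
`m ↦ m^{-1/q} (1 + log m)^α (∑_{i ≥ m} (c*_i)^2)^{1/2}`, `m = 1, 2, …`. -/
def normlR {ι : Type*} (q : ℝ≥0∞) (α : ℝ) (c : ι → ℂ) : ℝ≥0∞ :=
  eLpNorm (tailTerm q α c) q Measure.count

end LimitingFourier

end

/-! The estimate interpolates between the two bounds available for an orthonormal system bounded by
`M`: a finite sum has sup norm at most `M` times the sum of the moduli of its coefficients, and any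
sum has `L_2` norm at most the `l_2` norm of its coefficients. Splitting off the `k` largest
coefficients and applying the first bound to them and the second to the rest gives
`funHead_le_head_add_tail`: the head of `f*` up to `t` is at most `M t^{1/2} ∑_{j<k} c*_j` plus the
`l_2` tail of `c*` from `k` on.

Take `k = 2^m - 1` and `t = 2^{-(m+l)}` with `2^{l/2} ≥ M`, so that the `l` extra halvings of `t`
absorb `M`. Cauchy–Schwarz on dyadic blocks turns the bound into a convolution of the dyadic tails
with `2^{-i/2}` (`funHead_dyadic_le`). Geometric decay beats the logarithmic weights, so this
convolution is bounded on weighted `l_q` for every `q > 0`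
(`eLpNorm_logWeight_mul_le_of_le_convolution`). The shift by `l` costs `(1+l)^{|α|}`, and the first
`l` scales, where only the full `l_2` norm is used, cost a further `(1+l)^{1/q}`. As `l` is about `2
log_2 M`, the total is of order `(1 + log M)^{|α|+1/q}`, which both members of the minimum dominate
up to a constant.

A remainder of the series is again such a series, with some coefficients set to zero. Convergence in
quasi-norm thus follows from the inequality once the sequence quasi-norm of the remaining
coefficients tends to zero. -/

namespace LimitingFourier

/-! ### Rearrangements of functions -/

/-- The layer cake formula for `ℝ≥0∞`-valued functions. -/
theorem lintegral_eq_lintegral_meas_lt_ofReal {X : Type*} [MeasurableSpace X] {μ : Measure X}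
    [SFinite μ] {f : X → ℝ≥0∞} (hf : Measurable f) :
    ∫⁻ x, f x ∂μ = ∫⁻ s in Set.Ioi (0 : ℝ), μ {x | ENNReal.ofReal s < f x} := by
  have hvol : ∀ y : ℝ≥0∞, volume (Set.Ioi (0 : ℝ) ∩ {s | ENNReal.ofReal s < y}) = y := by
    intro y
    induction y with
    | top => simp
    | coe y =>
      have : Set.Ioi (0 : ℝ) ∩ {s | ENNReal.ofReal s < (y : ℝ≥0∞)} = Set.Ioo 0 (y : ℝ) := by
        ext s
        simp only [Set.mem_inter_iff, Set.mem_Ioi, Set.mem_ofPred_eq, Set.mem_Ioo]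
        refine and_congr_right fun hs => ?_
        rw [← ENNReal.ofReal_coe_nnreal, ENNReal.ofReal_lt_ofReal_iff_of_nonneg hs.le]
      rw [this]; simp
  have hmeas : MeasurableSet {p : X × ℝ | ENNReal.ofReal p.2 < f p.1} :=
    measurableSet_lt (by fun_prop) (by fun_prop)
  have h1 : ∀ x, f x = ∫⁻ s in Set.Ioi (0 : ℝ),
      {p : X × ℝ | ENNReal.ofReal p.2 < f p.1}.indicator (fun _ => (1 : ℝ≥0∞)) (x, s) := by
    intro x
    have : (fun s : ℝ => {p : X × ℝ | ENNReal.ofReal p.2 < f p.1}.indicator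
        (fun _ => (1 : ℝ≥0∞)) (x, s)) =
        {s : ℝ | ENNReal.ofReal s < f x}.indicator (fun _ => 1) := by
      ext s; simp [Set.indicator]
    rw [this, lintegral_indicator_const (measurableSet_lt (by fun_prop) (by fun_prop)), one_mul,
      Measure.restrict_apply (measurableSet_lt (by fun_prop) (by fun_prop)), Set.inter_comm, hvol]
  rw [lintegral_congr h1, lintegral_lintegral_swap]
  · refine lintegral_congr fun s => ?_
    have : (fun x : X => {p : X × ℝ | ENNReal.ofReal p.2 < f p.1}.indicator
        (fun _ => (1 : ℝ≥0∞)) (x, s)) =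
        {x : X | ENNReal.ofReal s < f x}.indicator (fun _ => 1) := by
      ext s; simp [Set.indicator]
    rw [this, lintegral_indicator_const (measurableSet_lt (by fun_prop) (by fun_prop)), one_mul]
  · exact (measurable_const.indicator hmeas).aemeasurable

theorem lintegral_le_lintegral_of_meas_lt_le {X Y : Type*} [MeasurableSpace X] [MeasurableSpace Y]
    {μ : Measure X} {ν : Measure Y} [SFinite μ] [SFinite ν] {f : X → ℝ≥0∞} {g : Y → ℝ≥0∞}
    (hf : Measurable f) (hg : AEMeasurable g ν)
    (h : ∀ s : ℝ≥0∞, μ {x | s < f x} ≤ ν {y | s < g y}) :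
    ∫⁻ x, f x ∂μ ≤ ∫⁻ y, g y ∂ν := by
  rw [lintegral_congr_ae hg.ae_eq_mk, lintegral_eq_lintegral_meas_lt_ofReal hf,
    lintegral_eq_lintegral_meas_lt_ofReal hg.measurable_mk]
  refine lintegral_mono fun s => (h _).trans_eq (measure_congr ?_)
  filter_upwards [hg.ae_eq_mk] with y hy
  change (_ < g y) = (_ < _)
  rw [hy]

theorem funRearr_antitone (f : ℝ → ℂ) : Antitone (funRearr f) := fun _ _ huv =>
  sInf_le_sInf fun _ hs => le_trans hs (ENNReal.ofReal_le_ofReal huv)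

/-- Up to a null set, `|f| > B + s` forces `|h| > s`, so every level admissible for `h` becomes
admissible for `f` after adding `B`. -/
theorem funRearr_le_add {f h : ℝ → ℂ} {B : ℝ≥0∞}
    (hfh : ∀ᵐ x ∂unitMeasure, ‖f x‖ₑ ≤ B + ‖h x‖ₑ) (u : ℝ) :
    funRearr f u ≤ B + funRearr h u := by
  rw [← tsub_le_iff_left]
  refine le_sInf fun s hs => tsub_le_iff_left.2 (sInf_le ?_)
  refine le_trans (measure_mono_ae ?_) hs
  filter_upwards [hfh] with x hx hx'
  have : B + s < B + ‖h x‖ₑ := lt_of_lt_of_le hx' hx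
  exact lt_of_add_lt_add_left this

/-- Half of equimeasurability suffices: `{u > 0 : h*(u) > r}` lies in the interval from `0` to
`|{|h| > r}|`, and the layer cake formula converts this into an inequality of integrals. -/
theorem lintegral_funRearr_sq_le {h : ℝ → ℂ} (hh : AEStronglyMeasurable h unitMeasure) (t : ℝ) :
    ∫⁻ u in Set.Ioo 0 t, funRearr h u ^ 2 ≤ ∫⁻ x, ‖h x‖ₑ ^ 2 ∂unitMeasure := by
  refine lintegral_le_lintegral_of_meas_lt_le ((funRearr_antitone h).measurable.pow_const 2)
    (hh.enorm.pow_const 2) fun s => ?_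
  obtain ⟨r, rfl⟩ : ∃ r : ℝ≥0∞, r ^ 2 = s :=
    ⟨s ^ (1 / 2 : ℝ), by rw [← ENNReal.rpow_natCast, ← ENNReal.rpow_mul]; norm_num⟩
  have hlt : ∀ a b : ℝ≥0∞, a ^ 2 < b ^ 2 ↔ a < b := fun a b =>
    (ENNReal.pow_right_strictMono two_ne_zero).lt_iff_lt
  simp only [hlt]
  rw [Measure.restrict_apply
    (measurableSet_lt measurable_const (funRearr_antitone h).measurable)]
  set m := unitMeasure {y | r < ‖h y‖ₑ}
  have hmt : m ≠ ∞ := measure_ne_top _ _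
  refine (measure_mono (t := Set.Ioo 0 m.toReal) ?_).trans (by simp [ENNReal.ofReal_toReal hmt])
  rintro u ⟨hu, hu0, -⟩
  refine ⟨hu0, ?_⟩
  by_contra! hcon
  refine absurd (show r < funRearr h u from hu) (not_lt.2 (sInf_le ?_))
  exact (ENNReal.le_ofReal_iff_toReal_le hmt hu0.le).2 hcon

theorem sqrt_lintegral_funRearr_sq_le {f h : ℝ → ℂ} {B : ℝ≥0∞}
    (hh : AEStronglyMeasurable h unitMeasure)
    (hfh : ∀ᵐ x ∂unitMeasure, ‖f x‖ₑ ≤ B + ‖h x‖ₑ) (t : ℝ) :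
    (∫⁻ u in Set.Ioo 0 t, funRearr f u ^ 2) ^ (1 / 2 : ℝ) ≤
      B * ENNReal.ofReal t ^ (1 / 2 : ℝ) +
        (∫⁻ x, ‖h x‖ₑ ^ 2 ∂unitMeasure) ^ (1 / 2 : ℝ) := by
  have hmink := ENNReal.lintegral_Lp_add_le (μ := volume.restrict (Set.Ioo 0 t)) (p := 2)
    (f := fun _ => B) (g := funRearr h) aemeasurable_const
    (funRearr_antitone h).measurable.aemeasurable (by norm_num)
  simp only [Pi.add_apply, ENNReal.rpow_two] at hmink
  calc (∫⁻ u in Set.Ioo 0 t, funRearr f u ^ 2) ^ (1 / 2 : ℝ)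
      ≤ (∫⁻ u in Set.Ioo 0 t, (B + funRearr h u) ^ 2) ^ (1 / 2 : ℝ) := by
        gcongr with u
        exact funRearr_le_add hfh u
    _ ≤ _ := hmink
    _ ≤ _ := by
        refine add_le_add ?_ (ENNReal.rpow_le_rpow (lintegral_funRearr_sq_le hh t) (by norm_num))
        · simp only [lintegral_const, Measure.restrict_apply MeasurableSet.univ, Set.univ_inter,
            Real.volume_Ioo, sub_zero]
          rw [ENNReal.mul_rpow_of_nonneg _ _ (by norm_num), ← ENNReal.rpow_two,
            ← ENNReal.rpow_mul]
          norm_num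

/-! ### Rearrangements of families of numbers -/

theorem seqRearr_le_iSup {ι : Type*} (c : ι → ℂ) (k : ℕ) : seqRearr c k ≤ ⨆ i, ‖c i‖ₑ := by
  refine sInf_le ?_
  have : {i | ⨆ i, ‖c i‖ₑ < ‖c i‖ₑ} = ∅ :=
    Set.eq_empty_of_forall_notMem fun i hi => not_lt.2 (le_iSup (fun i => ‖c i‖ₑ) i) hi
  simp [this]

theorem seqRearr_mono {ι : Type*} {c d : ι → ℂ} (h : ∀ i, ‖d i‖ₑ ≤ ‖c i‖ₑ) (k : ℕ) :
    seqRearr d k ≤ seqRearr c k :=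
  sInf_le_sInf fun _ hs => le_trans (Set.encard_le_encard fun i hi => lt_of_lt_of_le hi (h i)) hs

theorem finite_lt_enorm_of_tsum_seqRearr_ne_top {ι : Type*} {c : ι → ℂ}
    (hc : ∑' k, seqRearr c k ^ 2 ≠ ∞) {s : ℝ≥0∞} (hs : 0 < s) : {i | s < ‖c i‖ₑ}.Finite := by
  have h0 := ENNReal.tendsto_atTop_zero_of_tsum_ne_top hc
  obtain ⟨k, hk⟩ := (h0.eventually (gt_mem_nhds (ENNReal.pow_pos hs 2))).exists
  have hk' : seqRearr c k < s := (ENNReal.pow_right_strictMono two_ne_zero).lt_iff_lt.1 hk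
  obtain ⟨r, hr, hrs⟩ := sInf_lt_iff.1 hk'
  have : {i | r < ‖c i‖ₑ}.Finite :=
    Set.finite_of_encard_le_coe (k := k) hr
  exact this.subset fun i hi => hrs.trans hi

/-- A decreasing enumeration of the nonzero members of a family that tends to zero. -/
theorem exists_rank {ι : Type*} [Countable ι] {c : ι → ℂ}
    (hc : ∀ s : ℝ≥0∞, 0 < s → {i | s < ‖c i‖ₑ}.Finite) :
    ∃ σ : ι → ℕ, Set.InjOn σ {i | c i ≠ 0} ∧ ∀ i, c i ≠ 0 → ‖c i‖ₑ ≤ seqRearr c (σ i) := by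
  obtain ⟨enc, henc⟩ := exists_injective_nat ι
  -- The predecessors of `i`: larger moduli, with ties broken by the encoding. The rank of `i` is
  -- their number.
  set pre : ι → Set ι := fun i =>
    {j | ‖c i‖ₑ < ‖c j‖ₑ ∨ (‖c j‖ₑ = ‖c i‖ₑ ∧ enc j < enc i)} with hpre
  have hfin : ∀ i, c i ≠ 0 → (pre i).Finite := by
    intro i hi
    have h0 : ‖c i‖ₑ ≠ 0 := by simpa using hi
    refine (hc (‖c i‖ₑ / 2) (ENNReal.half_pos h0)).subset fun j hj => ?_
    have := ENNReal.half_lt_self h0 enorm_ne_top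
    rcases hj with hj | hj
    · exact this.trans hj
    · exact this.trans_eq hj.1.symm
  have hself : ∀ i, i ∉ pre i := by intro i; simp [hpre]
  have hlt : ∀ i j, c j ≠ 0 → i ∈ pre j → (pre i).ncard < (pre j).ncard := by
    intro i j hj hij
    refine Set.ncard_lt_ncard ⟨fun l hl => ?_, fun h => hself i (h hij)⟩ (hfin j hj)
    simp only [hpre, Set.mem_ofPred_eq] at hl hij ⊢
    rcases hl with hl | ⟨hl, hl'⟩ <;> rcases hij with h | ⟨h, h'⟩
    · exact .inl (h.trans hl)
    · exact .inl (h ▸ hl)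
    · exact .inl (hl ▸ h)
    · exact .inr ⟨hl.trans h, hl'.trans h'⟩
  refine ⟨fun i => (pre i).ncard, ?_, ?_⟩
  · intro i hi j hj hij
    by_contra hne
    have hne' : enc i ≠ enc j := fun h => hne (henc h)
    have : i ∈ pre j ∨ j ∈ pre i := by
      simp only [hpre, Set.mem_ofPred_eq]
      rcases lt_trichotomy ‖c i‖ₑ ‖c j‖ₑ with h | h | h
      · exact .inr (.inl h)
      · rcases lt_or_gt_of_ne hne' with h' | h'
        · exact .inl (.inr ⟨h, h'⟩)
        · exact .inr (.inr ⟨h.symm, h'⟩)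
      · exact .inl (.inl h)
    rcases this with h | h
    · exact (hlt _ _ hj h).ne hij
    · exact (hlt _ _ hi h).ne hij.symm
  · intro i hi
    refine le_sInf fun s hs => ?_
    by_contra! hlt'
    -- If `s < |c i|`, then `i` and its predecessors all exceed `s`: one more index than the rank
    -- allows.
    have hsub : insert i (pre i) ⊆ {j | s < ‖c j‖ₑ} := by
      rintro j (rfl | hj | hj)
      · exact hlt'
      · exact hlt'.trans hj
      · exact hlt'.trans_eq hj.1.symm
    have h1 := (Set.encard_le_encard hsub).trans hs
    rw [Set.encard_insert_of_notMem (hself i), ← (hfin i hi).cast_ncard_eq] at h1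
    have h2 : (pre i).ncard + 1 ≤ (pre i).ncard := by exact_mod_cast h1
    omega

/-- Separation of the `k` largest members of a square-summable family. -/
theorem exists_finset_largest {ι : Type*} [Countable ι] [DecidableEq ι] {c : ι → ℂ}
    (hc : ∑' k, seqRearr c k ^ 2 ≠ ∞) (k : ℕ) :
    ∃ S : Finset ι, ∑ i ∈ S, ‖c i‖ₑ ≤ ∑ j ∈ Finset.range k, seqRearr c j ∧
      ∑' i, (if i ∈ S then 0 else ‖c i‖ₑ ^ 2) ≤ ∑' j, seqRearr c (k + j) ^ 2 := by
  obtain ⟨σ, hinj, hσ⟩ := exists_rank fun s hs => finite_lt_enorm_of_tsum_seqRearr_ne_top hc hs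
  -- The nonzero members of rank below `k`; there may be fewer than `k` of them.
  have hfin : {i | c i ≠ 0 ∧ σ i < k}.Finite := by
    refine Set.Finite.of_finite_image (f := σ) ((Set.finite_lt_nat k).subset ?_)
      (hinj.mono fun i hi => hi.1)
    rintro _ ⟨i, hi, rfl⟩
    exact hi.2
  refine ⟨hfin.toFinset, ?_, ?_⟩
  · calc ∑ i ∈ hfin.toFinset, ‖c i‖ₑ ≤ ∑ i ∈ hfin.toFinset, seqRearr c (σ i) :=
        Finset.sum_le_sum fun i hi => hσ i (by simp at hi; exact hi.1)
      _ = ∑ j ∈ hfin.toFinset.image σ, seqRearr c j := by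
        rw [Finset.sum_image]
        intro i hi j hj
        exact hinj (by simp at hi; exact hi.1) (by simp at hj; exact hj.1)
      _ ≤ _ := by
        refine Finset.sum_le_sum_of_subset fun j hj => ?_
        simp only [Finset.mem_image, Set.Finite.mem_toFinset] at hj
        obtain ⟨i, hi, rfl⟩ := hj
        exact Finset.mem_range.2 hi.2
  · have hA : ∑' i, (if i ∈ hfin.toFinset then 0 else ‖c i‖ₑ ^ 2) =
        ∑' i, {i | c i ≠ 0 ∧ k ≤ σ i}.indicator (fun i => ‖c i‖ₑ ^ 2) i := by
      refine tsum_congr fun i => ?_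
      by_cases h0 : c i = 0
      · simp [Set.indicator, h0]
      · by_cases hk : σ i < k
        · simp [Set.indicator, h0, hk]
        · simp [Set.indicator, h0, hk, not_lt.1 hk]
    rw [hA, ← tsum_subtype]
    calc _ ≤ ∑' i : {i | c i ≠ 0 ∧ k ≤ σ i}, seqRearr c (k + (σ i - k)) ^ 2 := by
          refine ENNReal.tsum_le_tsum fun i => ?_
          rw [Nat.add_sub_cancel' i.2.2]
          gcongr
          exact hσ i i.2.1
      _ ≤ _ := by
          refine ENNReal.tsum_comp_le_tsum_of_injective
            (f := fun i : {i | c i ≠ 0 ∧ k ≤ σ i} => σ i - k) ?_ (fun j => seqRearr c (k + j) ^ 2)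
          intro i j hij
          refine Subtype.ext (hinj i.2.1 j.2.1 ?_)
          have h1 := i.2.2
          have h2 := j.2.2
          simp only at hij
          omega

/-! ### Orthonormal series -/

theorem enorm_sq_sum_smul_of_orthonormal {ι H : Type*} [NormedAddCommGroup H]
    [InnerProductSpace ℂ H] {φ : ι → H} (hφ : Orthonormal ℂ φ) (c : ι → ℂ) (F : Finset ι) :
    ‖∑ n ∈ F, c n • φ n‖ₑ ^ 2 = ∑ n ∈ F, ‖c n‖ₑ ^ 2 := by
  have h := hφ.orthogonalFamily.norm_sum c F
  simp only [LinearIsometry.toSpanSingleton_apply] at h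
  simp only [← ofReal_norm, ← ENNReal.ofReal_pow (norm_nonneg _)]
  rw [h, ENNReal.ofReal_sum_of_nonneg fun i _ => by positivity]

theorem enorm_sq_le_tsum_of_orthonormal {ι H : Type*} [NormedAddCommGroup H]
    [InnerProductSpace ℂ H] {φ : ι → H} (hφ : Orthonormal ℂ φ) {c : ι → ℂ} {f : H}
    (hf : HasSum (fun n => c n • φ n) f) : ‖f‖ₑ ^ 2 ≤ ∑' n, ‖c n‖ₑ ^ 2 := by
  have h : Tendsto (fun F : Finset ι => ‖∑ n ∈ F, c n • φ n‖ₑ ^ 2) atTop (𝓝 (‖f‖ₑ ^ 2)) :=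
    ((ENNReal.continuous_pow 2).comp continuous_enorm).continuousAt.tendsto.comp hf
  refine le_of_tendsto' h fun F => ?_
  rw [enorm_sq_sum_smul_of_orthonormal hφ]
  exact ENNReal.sum_le_tsum F

theorem summable_smul_of_orthonormal {ι H : Type*} [NormedAddCommGroup H]
    [InnerProductSpace ℂ H] [CompleteSpace H] {φ : ι → H} (hφ : Orthonormal ℂ φ) {c : ι → ℂ}
    (hc : ∑' n, ‖c n‖ₑ ^ 2 ≠ ∞) : Summable fun n => c n • φ n := by
  have h := (hφ.orthogonalFamily.summable_iff_norm_sq_summable c).2 (by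
    refine (ENNReal.summable_toReal hc).congr fun n => ?_
    simp)
  simpa only [LinearIsometry.toSpanSingleton_apply] using h

/-- Keeping the index set and zeroing coefficients lets every estimate for the full series apply to
remainders with the same system and the same `M`. -/
theorem hasSum_remainder {ι H : Type*} [DecidableEq ι] [NormedAddCommGroup H] [NormedSpace ℂ H]
    {φ : ι → H} {c : ι → ℂ} {f : H} (hf : HasSum (fun n => c n • φ n) f) (F : Finset ι) :
    HasSum (fun n => (if n ∈ F then 0 else c n) • φ n) (f - ∑ n ∈ F, c n • φ n) := by
  have h1 : HasSum (fun n => (if n ∈ F then c n else 0) • φ n) (∑ n ∈ F, c n • φ n) := by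
    have := hasSum_sum_of_ne_finset_zero (L := .unconditional ι)
      (f := fun n => (if n ∈ F then c n else 0) • φ n) (s := F) (fun b hb => by simp [hb])
    rwa [Finset.sum_congr rfl fun n hn => by rw [if_pos hn]] at this
  convert hf.sub h1 using 2 with n
  by_cases hn : n ∈ F <;> simp [hn]

theorem lintegral_enorm_sq_eq (h : Lp ℂ 2 unitMeasure) :
    ∫⁻ x, ‖h x‖ₑ ^ 2 ∂unitMeasure = ‖h‖ₑ ^ 2 := by
  rw [Lp.enorm_def, eLpNorm_eq_lintegral_rpow_enorm_toReal two_ne_zero ENNReal.ofNat_ne_top,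
    ← ENNReal.rpow_natCast, ← ENNReal.rpow_mul]
  norm_num

theorem enorm_sum_smul_le_ae {ι : Type*} {φ : ι → Lp ℂ 2 unitMeasure} {M : ℝ≥0∞}
    (hM : ∀ n, eLpNorm (φ n) ∞ unitMeasure ≤ M) (c : ι → ℂ) (S : Finset ι) :
    ∀ᵐ x ∂unitMeasure, ‖(∑ n ∈ S, c n • φ n : Lp ℂ 2 unitMeasure) x‖ₑ ≤
      M * ∑ n ∈ S, ‖c n‖ₑ := by
  classical
  induction S using Finset.induction_on with
  | empty =>
    simp only [Finset.sum_empty]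
    filter_upwards [Lp.coeFn_zero ℂ 2 unitMeasure] with x hx
    rw [hx]
    simp
  | insert a S ha ih =>
    rw [Finset.sum_insert ha, Finset.sum_insert ha]
    filter_upwards [ih, Lp.coeFn_add (c a • φ a) (∑ n ∈ S, c n • φ n),
      Lp.coeFn_smul (c a) (φ a), enorm_ae_le_eLpNormEssSup (φ a) unitMeasure]
      with x h1 h2 h3 h4
    have h5 : ‖φ a x‖ₑ ≤ M := h4.trans (by simpa using hM a)
    rw [h2, Pi.add_apply, h3, Pi.smul_apply]
    refine (enorm_add_le _ _).trans ?_
    rw [mul_add, enorm_smul, mul_comm M]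
    gcongr

theorem tsum_enorm_sq_le {ι : Type*} [Countable ι] {c : ι → ℂ}
    (hc : ∑' k, seqRearr c k ^ 2 ≠ ∞) : ∑' i, ‖c i‖ₑ ^ 2 ≤ ∑' k, seqRearr c k ^ 2 := by
  classical
  -- With `k = 0` the coefficients on `S` all vanish, so the part outside `S` is the whole sum.
  obtain ⟨S, h1, h2⟩ := exists_finset_largest hc 0
  have h0 : ∀ i ∈ S, ‖c i‖ₑ = 0 := Finset.sum_eq_zero_iff.1 (by simpa using h1)
  simp only [zero_add] at h2
  refine le_trans (ENNReal.tsum_le_tsum fun i => ?_) h2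
  split_ifs with hi
  · simp [h0 i hi]
  · exact le_rfl

/-- The square root of the tail sum `∑_{i ≥ k} (c*_{i+1})^2`. -/
noncomputable def seqTail {ι : Type*} (c : ι → ℂ) (k : ℕ) : ℝ≥0∞ :=
  (∑' i : ℕ, seqRearr c (k + i) ^ 2) ^ (1 / 2 : ℝ)

/-- The square root of `∫_0^t f*(u)^2 du`. -/
noncomputable def funHead (f : ℝ → ℂ) (t : ℝ) : ℝ≥0∞ :=
  (∫⁻ u in Set.Ioo 0 t, funRearr f u ^ 2) ^ (1 / 2 : ℝ)

theorem seqTail_antitone {ι : Type*} (c : ι → ℂ) : Antitone (seqTail c) := by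
  intro k l hkl
  refine ENNReal.rpow_le_rpow ?_ (by norm_num)
  refine le_trans (le_of_eq (tsum_congr fun i => ?_)) (ENNReal.tsum_comp_le_tsum_of_injective
    (add_right_injective (l - k)) fun j => seqRearr c (k + j) ^ 2)
  rw [← add_assoc, Nat.add_sub_cancel' hkl]

theorem tsum_ne_top_of_seqTail_zero_ne_top {ι : Type*} {c : ι → ℂ} (hc : seqTail c 0 ≠ ∞) :
    ∑' k, seqRearr c k ^ 2 ≠ ∞ := by
  intro h
  refine hc ?_
  simp only [seqTail, zero_add, h]
  simp

theorem funHead_mono (f : ℝ → ℂ) : Monotone (funHead f) := by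
  intro s t hst
  exact ENNReal.rpow_le_rpow (lintegral_mono_set (Set.Ioo_subset_Ioo_right hst)) (by norm_num)

/-- With `g` the partial sum over the largest coefficients, `g` is bounded uniformly and `f - g` in
`L_2` by Bessel. Minkowski in `L_2(0,t)` gives the factor `t^{1/2}` on the bounded part. -/
theorem funHead_le_head_add_tail {ι : Type*} [Countable ι] {φ : ι → Lp ℂ 2 unitMeasure}
    (hφ : Orthonormal ℂ φ) {M : ℝ≥0∞} (hM : ∀ n, eLpNorm (φ n) ∞ unitMeasure ≤ M)
    {c : ι → ℂ} (hc : seqTail c 0 ≠ ∞) {f : Lp ℂ 2 unitMeasure}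
    (hf : HasSum (fun n => c n • φ n) f) (k : ℕ) (t : ℝ) :
    funHead f t ≤ M * (∑ j ∈ Finset.range k, seqRearr c j) * ENNReal.ofReal t ^ (1 / 2 : ℝ) +
      seqTail c k := by
  classical
  obtain ⟨S, hS1, hS2⟩ := exists_finset_largest (tsum_ne_top_of_seqTail_zero_ne_top hc) k
  set g : Lp ℂ 2 unitMeasure := ∑ n ∈ S, c n • φ n
  have hh := hasSum_remainder hf S
  have hnorm : ‖f - g‖ₑ ^ 2 ≤ ∑' j, seqRearr c (k + j) ^ 2 := by
    refine (enorm_sq_le_tsum_of_orthonormal hφ hh).trans (le_trans (le_of_eq ?_) hS2)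
    refine tsum_congr fun n => ?_
    split_ifs <;> simp
  have hae : ∀ᵐ x ∂unitMeasure, ‖f x‖ₑ ≤ M * ∑ n ∈ S, ‖c n‖ₑ + ‖(f - g) x‖ₑ := by
    filter_upwards [enorm_sum_smul_le_ae hM c S, Lp.coeFn_sub f g] with x h1 h2
    have : f x = g x + (f - g) x := by rw [h2, Pi.sub_apply]; ring
    rw [this]
    exact (enorm_add_le _ _).trans (by gcongr)
  refine (sqrt_lintegral_funRearr_sq_le (Lp.aestronglyMeasurable (f - g)) hae t).trans ?_
  rw [lintegral_enorm_sq_eq]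
  refine add_le_add ?_ (ENNReal.rpow_le_rpow hnorm (by norm_num))
  gcongr

/-! ### Dyadic blocks -/

/-- Since numbering starts at `0`, the `j`-th block is `[2^j - 1, 2^{j+1} - 1)`, of length `2^j`.
Cauchy–Schwarz bounds its sum by `2^{j/2}` times the tail from its left end. -/
theorem sum_range_two_pow_le {ι : Type*} (c : ι → ℂ) (J : ℕ) :
    ∑ j ∈ Finset.range (2 ^ J - 1), seqRearr c j ≤
      ∑ j ∈ Finset.range J, (2 : ℝ≥0∞) ^ ((j : ℝ) / 2) * seqTail c (2 ^ j - 1) := by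
  induction J with
  | zero => simp
  | succ J ih =>
    have h2 : 2 ^ (J + 1) - 1 = (2 ^ J - 1) + 2 ^ J := by
      have := Nat.one_le_two_pow (n := J)
      rw [pow_succ]; omega
    rw [h2, Finset.sum_range_add, Finset.sum_range_succ _ J]
    refine add_le_add ih ?_
    have hcs := ENNReal.rpow_sum_le_const_mul_sum_rpow (Finset.range (2 ^ J))
      (fun i => seqRearr c (2 ^ J - 1 + i)) (p := 2) (by norm_num)
    have hcs' := ENNReal.rpow_le_rpow hcs (z := 1 / 2) (by norm_num)
    rw [← ENNReal.rpow_mul, ENNReal.mul_rpow_of_nonneg _ _ (by norm_num)] at hcs'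
    norm_num at hcs'
    refine hcs'.trans ?_
    rw [seqTail]
    refine mul_le_mul' (le_of_eq ?_) (ENNReal.rpow_le_rpow ?_ (by norm_num))
    · rw [← ENNReal.rpow_natCast, ← ENNReal.rpow_mul]; congr 1; ring
    · exact ENNReal.sum_le_tsum _

theorem funHead_dyadic_le {ι : Type*} [Countable ι] {φ : ι → Lp ℂ 2 unitMeasure}
    (hφ : Orthonormal ℂ φ) {M : ℝ≥0∞} (hM : ∀ n, eLpNorm (φ n) ∞ unitMeasure ≤ M)
    {c : ι → ℂ} (hc : seqTail c 0 ≠ ∞) {f : Lp ℂ 2 unitMeasure}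
    (hf : HasSum (fun n => c n • φ n) f) {l : ℕ} (hl : M ≤ (2 : ℝ≥0∞) ^ ((l : ℝ) / 2)) (m : ℕ) :
    funHead f ((2 : ℝ)⁻¹ ^ (m + l)) ≤
      ∑ i ∈ Finset.range (m + 1), (2 : ℝ≥0∞) ^ (-(i : ℝ) / 2) * seqTail c (2 ^ (m - i) - 1) := by
  refine (funHead_le_head_add_tail hφ hM hc hf (2 ^ m - 1) _).trans ?_
  have ht : ENNReal.ofReal ((2 : ℝ)⁻¹ ^ (m + l)) ^ (1 / 2 : ℝ) =
      (2 : ℝ≥0∞) ^ (-((m : ℝ) + l) / 2) := by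
    rw [ENNReal.ofReal_pow (by norm_num), ENNReal.ofReal_inv_of_pos (by norm_num),
      ENNReal.ofReal_ofNat, ← ENNReal.rpow_neg_one, ← ENNReal.rpow_natCast, ← ENNReal.rpow_mul,
      ← ENNReal.rpow_mul]
    congr 1
    push_cast; ring
  -- Reflection makes the index the distance `m - j` to the current scale; the summand at distance
  -- `0` is the tail term.
  rw [ht, ← Finset.sum_range_reflect _ (m + 1), Finset.sum_range_succ _ m]
  have h2 : ∀ x y : ℝ, (2 : ℝ≥0∞) ^ x * 2 ^ y = 2 ^ (x + y) := fun x y =>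
    (ENNReal.rpow_add x y two_ne_zero ENNReal.ofNat_ne_top).symm
  refine add_le_add ?_ (by simp)
  calc _ ≤ (2 : ℝ≥0∞) ^ ((l : ℝ) / 2) *
        (∑ j ∈ Finset.range m, (2 : ℝ≥0∞) ^ ((j : ℝ) / 2) * seqTail c (2 ^ j - 1)) *
          2 ^ (-((m : ℝ) + l) / 2) := by
        gcongr
        exact sum_range_two_pow_le c m
    _ = 2 ^ ((l : ℝ) / 2 + -((m : ℝ) + l) / 2) *
        (∑ j ∈ Finset.range m, (2 : ℝ≥0∞) ^ ((j : ℝ) / 2) * seqTail c (2 ^ j - 1)) := by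
        rw [← h2]; ring
    _ = _ := by
        rw [Finset.mul_sum]
        refine Finset.sum_congr rfl fun j hj => ?_
        have hj' : j < m := Finset.mem_range.1 hj
        have e1 : m - (m + 1 - 1 - j) = j := by omega
        have e2 : ((m + 1 - 1 - j : ℕ) : ℝ) = m - j := by
          rw [Nat.add_sub_cancel, Nat.cast_sub hj'.le]
        rw [e1, e2, ← mul_assoc, h2]
        congr 2; ring

/-- The case `k = 0`, free of `M`; it serves the first `l` dyadic scales. -/
theorem funHead_le_seqTail_zero {ι : Type*} [Countable ι] {φ : ι → Lp ℂ 2 unitMeasure}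
    (hφ : Orthonormal ℂ φ) {M : ℝ≥0∞} (hM : ∀ n, eLpNorm (φ n) ∞ unitMeasure ≤ M)
    {c : ι → ℂ} (hc : seqTail c 0 ≠ ∞) {f : Lp ℂ 2 unitMeasure}
    (hf : HasSum (fun n => c n • φ n) f) (t : ℝ) : funHead f t ≤ seqTail c 0 := by
  simpa using funHead_le_head_add_tail hφ hM hc hf 0 t

/-! ### Logarithmic weights -/

theorem rpow_le_mul_rpow_of_comparable {x y K : ℝ} (hx : 0 < x) (hy : 0 < y) (hK : 0 < K)
    (hxy : x ≤ K * y) (hyx : y ≤ K * x) (α : ℝ) : x ^ α ≤ K ^ |α| * y ^ α := by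
  rcases le_total 0 α with h | h
  · rw [abs_of_nonneg h, ← Real.mul_rpow hK.le hy.le]
    exact Real.rpow_le_rpow hx.le hxy h
  · rw [abs_of_nonpos h, Real.rpow_neg hK.le, ← div_eq_inv_mul, le_div_iff₀ (by positivity),
      mul_comm, ← Real.mul_rpow hK.le hx.le]
    exact Real.rpow_le_rpow_of_nonpos hy hyx h

/-- The weight `(1 + n)^α`. -/
noncomputable def logWeight (α : ℝ) (n : ℕ) : ℝ≥0∞ := ENNReal.ofReal ((1 + (n : ℝ)) ^ α)

/-- Both `1+m+l ≤ (1+l)(1+m)` and `1+m ≤ (1+l)(1+m+l)` hold, which covers either sign of `α`. -/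
theorem logWeight_add_le (α : ℝ) (m l : ℕ) :
    logWeight α (m + l) ≤ logWeight |α| l * logWeight α m := by
  unfold logWeight
  rw [← ENNReal.ofReal_mul (by positivity)]
  refine ENNReal.ofReal_le_ofReal (rpow_le_mul_rpow_of_comparable (by positivity) (by positivity)
    (by positivity) ?_ ?_ α)
  · push_cast; nlinarith [mul_nonneg (Nat.cast_nonneg (α := ℝ) m) (Nat.cast_nonneg (α := ℝ) l)]
  · push_cast
    nlinarith [mul_nonneg (Nat.cast_nonneg (α := ℝ) m) (Nat.cast_nonneg (α := ℝ) l),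
      mul_nonneg (Nat.cast_nonneg (α := ℝ) l) (Nat.cast_nonneg (α := ℝ) l),
      Nat.cast_nonneg (α := ℝ) l]

theorem logWeight_le_of_le {α : ℝ} {n l : ℕ} (h : n ≤ l) : logWeight α n ≤ logWeight |α| l := by
  unfold logWeight
  refine ENNReal.ofReal_le_ofReal ?_
  have h1 : (1 : ℝ) ≤ 1 + n := by simp
  have h2 : (n : ℝ) ≤ l := by exact_mod_cast h
  calc (1 + (n : ℝ)) ^ α ≤ (1 + (n : ℝ)) ^ |α| :=
        Real.rpow_le_rpow_of_exponent_le h1 (le_abs_self α)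
    _ ≤ _ := Real.rpow_le_rpow (by positivity) (by linarith) (abs_nonneg α)

@[simp] theorem logWeight_zero (α : ℝ) : logWeight α 0 = 1 := by simp [logWeight]

theorem ofReal_two_rpow (x : ℝ) : ENNReal.ofReal ((2 : ℝ) ^ x) = (2 : ℝ≥0∞) ^ x := by
  rw [← ENNReal.ofReal_rpow_of_pos (by norm_num), ENNReal.ofReal_ofNat]

/-- As `1/2 < log 2 < 1`, the numbers `1 + |log t|` and `1 + n` agree within a factor `2`. After
raising to the power `q`, the factor `2^{(n+1)/q}` cancels the interval's length `2^{-(n+1)}`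
exactly. -/
theorem weight_le_of_mem_Ioc (q : ℝ≥0∞) (α : ℝ) {n : ℕ} {t : ℝ}
    (ht : t ∈ Set.Ioc ((2 : ℝ)⁻¹ ^ (n + 1)) ((2 : ℝ)⁻¹ ^ n)) :
    weight q α t ≤ (2 : ℝ≥0∞) ^ |α| * (2 : ℝ≥0∞) ^ (((n : ℝ) + 1) * (q⁻¹).toReal) *
      logWeight α n := by
  have ht0 : 0 < t := lt_trans (by positivity) ht.1
  have hl1 : -((n + 1) * Real.log 2) ≤ Real.log t := by
    have := Real.log_le_log (by positivity) ht.1.le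
    rw [Real.log_pow, Real.log_inv] at this
    push_cast at this; linarith
  have hl2 : Real.log t ≤ -(n * Real.log 2) := by
    have := Real.log_le_log ht0 ht.2
    rw [Real.log_pow, Real.log_inv] at this
    linarith
  have hlog1 := Real.log_two_gt_d9
  have hlog2 := Real.log_two_lt_d9
  have hn : (0 : ℝ) ≤ n := Nat.cast_nonneg n
  have habs : |Real.log t| = -Real.log t := abs_of_nonpos (hl2.trans (by nlinarith))
  have h1 : (1 + |Real.log t|) ^ α ≤ 2 ^ |α| * (1 + (n : ℝ)) ^ α := by
    rw [habs]
    refine rpow_le_mul_rpow_of_comparable ?_ (by positivity) (by norm_num) ?_ ?_ α <;> nlinarith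
  have h2 : t ^ (-(q⁻¹).toReal) ≤ 2 ^ (((n : ℝ) + 1) * (q⁻¹).toReal) := by
    refine (Real.rpow_le_rpow_of_nonpos (by positivity) ht.1.le (by simp)).trans_eq ?_
    rw [← Real.rpow_natCast, ← Real.rpow_mul (by norm_num), Real.inv_rpow (by norm_num),
      ← Real.rpow_neg (by norm_num)]
    congr 1; push_cast; ring
  rw [weight, logWeight, ← ofReal_two_rpow, ← ofReal_two_rpow,
    ← ENNReal.ofReal_mul (by positivity), ← ENNReal.ofReal_mul (by positivity)]
  refine ENNReal.ofReal_le_ofReal ?_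
  calc _ ≤ 2 ^ (((n : ℝ) + 1) * (q⁻¹).toReal) * (2 ^ |α| * (1 + (n : ℝ)) ^ α) :=
        mul_le_mul h2 h1 (by positivity) (by positivity)
    _ = _ := by ring

theorem logWeight_le_mul_weight (q : ℝ≥0∞) (α : ℝ) {j k : ℕ} (h1 : 2 ^ j ≤ 2 * (k + 1))
    (h2 : k + 1 ≤ 2 ^ j) :
    logWeight α j ≤ (2 : ℝ≥0∞) ^ |α| * (2 : ℝ≥0∞) ^ ((j : ℝ) * (q⁻¹).toReal) *
      weight q α ((k : ℝ) + 1) := by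
  have hk : (0 : ℝ) < (k : ℝ) + 1 := by positivity
  have h1' : (2 : ℝ) ^ j ≤ 2 * ((k : ℝ) + 1) := by exact_mod_cast h1
  have h2' : (k : ℝ) + 1 ≤ 2 ^ j := by exact_mod_cast h2
  have hl1 : j * Real.log 2 ≤ Real.log 2 + Real.log ((k : ℝ) + 1) := by
    have := Real.log_le_log (by positivity) h1'
    rwa [Real.log_pow, Real.log_mul (by norm_num) hk.ne'] at this
  have hl2 : Real.log ((k : ℝ) + 1) ≤ j * Real.log 2 := by
    have := Real.log_le_log hk h2'
    rwa [Real.log_pow] at this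
  have hlog1 := Real.log_two_gt_d9
  have hlog2 := Real.log_two_lt_d9
  have hj : (0 : ℝ) ≤ j := Nat.cast_nonneg j
  have hl0 : 0 ≤ Real.log ((k : ℝ) + 1) := Real.log_nonneg (by simp)
  have hw : (1 + (j : ℝ)) ^ α ≤ 2 ^ |α| * (1 + |Real.log ((k : ℝ) + 1)|) ^ α := by
    rw [abs_of_nonneg hl0]
    refine rpow_le_mul_rpow_of_comparable (by positivity) (by positivity) (by norm_num) ?_ ?_ α
      <;> nlinarith
  have hp : 1 ≤ 2 ^ ((j : ℝ) * (q⁻¹).toReal) * ((k : ℝ) + 1) ^ (-(q⁻¹).toReal) := by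
    rw [Real.rpow_mul (by norm_num), Real.rpow_neg hk.le, ← div_eq_mul_inv,
      one_le_div (by positivity), Real.rpow_natCast]
    exact Real.rpow_le_rpow hk.le h2' (by simp)
  rw [weight, logWeight, ← ofReal_two_rpow, ← ofReal_two_rpow,
    ← ENNReal.ofReal_mul (by positivity), ← ENNReal.ofReal_mul (by positivity)]
  refine ENNReal.ofReal_le_ofReal (hw.trans ?_)
  calc _ ≤ (2 ^ |α| * (1 + |Real.log ((k : ℝ) + 1)|) ^ α) *
        (2 ^ ((j : ℝ) * (q⁻¹).toReal) * ((k : ℝ) + 1) ^ (-(q⁻¹).toReal)) :=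
        le_mul_of_one_le_right (by positivity) hp
    _ = _ := by ring

/-! ### Passage to dyadic sums -/

theorem eLpNorm_top_count_eq_iSup (g : ℕ → ℝ≥0∞) :
    eLpNorm g ∞ Measure.count = ⨆ n, g n := by
  simp [eLpNorm_exponent_top, eLpNormEssSup]

theorem eLpNorm_count_eq_tsum {q : ℝ≥0∞} (hq : q ≠ 0) (hq' : q ≠ ∞) (g : ℕ → ℝ≥0∞) :
    eLpNorm g q Measure.count = (∑' n, g n ^ q.toReal) ^ (1 / q.toReal) := by
  simp [eLpNorm_eq_lintegral_rpow_enorm_toReal hq hq', lintegral_count]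

theorem rpow_mul_toReal_inv_rpow {q : ℝ≥0∞} (hq : q ≠ 0) (hq' : q ≠ ∞) (x : ℝ) :
    ((2 : ℝ≥0∞) ^ (x * (q⁻¹).toReal)) ^ q.toReal = 2 ^ x := by
  have := ENNReal.toReal_pos hq hq'
  rw [← ENNReal.rpow_mul, ENNReal.toReal_inv, mul_assoc, inv_mul_cancel₀ this.ne', mul_one]

theorem Ioo_zero_one_subset_iUnion_dyadic :
    Set.Ioo (0 : ℝ) 1 ⊆ ⋃ n : ℕ, Set.Ioc ((2 : ℝ)⁻¹ ^ (n + 1)) ((2 : ℝ)⁻¹ ^ n) := by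
  intro t ht
  obtain ⟨n, hn⟩ := exists_nat_pow_near_of_lt_one ht.1 ht.2.le (y := (2 : ℝ)⁻¹)
    (by norm_num) (by norm_num)
  exact Set.mem_iUnion.2 ⟨n, hn⟩

theorem normLL_le_dyadic {q : ℝ≥0∞} (hq : q ≠ 0) (α : ℝ) (f : ℝ → ℂ) :
    normLL q α f ≤ (2 : ℝ≥0∞) ^ |α| *
      eLpNorm (fun n : ℕ => logWeight α n * funHead f ((2 : ℝ)⁻¹ ^ n)) q Measure.count := by
  have hpt : ∀ (n : ℕ) (t : ℝ), t ∈ Set.Ioc ((2 : ℝ)⁻¹ ^ (n + 1)) ((2 : ℝ)⁻¹ ^ n) →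
      weight q α t * funHead f t ≤ (2 : ℝ≥0∞) ^ (((n : ℝ) + 1) * (q⁻¹).toReal) *
        ((2 : ℝ≥0∞) ^ |α| * (logWeight α n * funHead f ((2 : ℝ)⁻¹ ^ n))) := by
    intro n t ht
    refine (mul_le_mul' (weight_le_of_mem_Ioc q α ht) (funHead_mono f ht.2)).trans_eq ?_
    ring
  change eLpNorm (fun t => weight q α t * funHead f t) q _ ≤ _
  by_cases hq' : q = ∞
  · subst hq'
    rw [eLpNorm_top_count_eq_iSup, eLpNorm_exponent_top, eLpNormEssSup]
    refine essSup_le_of_ae_le _ ?_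
    filter_upwards [ae_restrict_mem measurableSet_Ioo] with t ht
    obtain ⟨n, hn⟩ := Set.mem_iUnion.1 (Ioo_zero_one_subset_iUnion_dyadic ht)
    refine (hpt n t hn).trans ?_
    simp only [ENNReal.inv_top, ENNReal.toReal_zero, mul_zero, ENNReal.rpow_zero, one_mul]
    gcongr
    exact le_iSup (fun n => logWeight α n * funHead f ((2 : ℝ)⁻¹ ^ n)) n
  · have hp := ENNReal.toReal_pos hq hq'
    rw [eLpNorm_count_eq_tsum hq hq', eLpNorm_eq_lintegral_rpow_enorm_toReal hq hq']
    simp only [enorm_eq_self]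
    have hblock : ∀ n : ℕ, ∫⁻ t in Set.Ioc ((2 : ℝ)⁻¹ ^ (n + 1)) ((2 : ℝ)⁻¹ ^ n),
        (weight q α t * funHead f t) ^ q.toReal ≤
        ((2 : ℝ≥0∞) ^ |α|) ^ q.toReal *
          (logWeight α n * funHead f ((2 : ℝ)⁻¹ ^ n)) ^ q.toReal := by
      intro n
      have hvol : volume (Set.Ioc ((2 : ℝ)⁻¹ ^ (n + 1)) ((2 : ℝ)⁻¹ ^ n)) =
          (2 : ℝ≥0∞) ^ (-((n : ℝ) + 1)) := by
        rw [Real.volume_Ioc, ← ofReal_two_rpow]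
        congr 1
        rw [Real.rpow_neg (by norm_num)]
        have : ((n : ℝ) + 1) = ((n + 1 : ℕ) : ℝ) := by push_cast; ring
        rw [this, Real.rpow_natCast, inv_pow, inv_pow, pow_succ]
        field_simp; norm_num
      calc _ ≤ ∫⁻ t in Set.Ioc ((2 : ℝ)⁻¹ ^ (n + 1)) ((2 : ℝ)⁻¹ ^ n),
          ((2 : ℝ≥0∞) ^ (((n : ℝ) + 1) * (q⁻¹).toReal) *
          ((2 : ℝ≥0∞) ^ |α| * (logWeight α n * funHead f ((2 : ℝ)⁻¹ ^ n)))) ^ q.toReal :=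
            setLIntegral_mono' measurableSet_Ioc fun t ht =>
              ENNReal.rpow_le_rpow (hpt n t ht) hp.le
        _ = _ := by
          rw [setLIntegral_const, hvol, ENNReal.mul_rpow_of_nonneg _ _ hp.le,
            rpow_mul_toReal_inv_rpow hq hq', ENNReal.mul_rpow_of_nonneg _ _ hp.le, mul_comm,
            ← mul_assoc, ← ENNReal.rpow_add _ _ two_ne_zero ENNReal.ofNat_ne_top]
          simp
    calc _ ≤ (∑' n : ℕ, ((2 : ℝ≥0∞) ^ |α|) ^ q.toReal *
          (logWeight α n * funHead f ((2 : ℝ)⁻¹ ^ n)) ^ q.toReal) ^ (1 / q.toReal) := by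
          refine ENNReal.rpow_le_rpow ?_ (by positivity)
          exact (lintegral_mono_set Ioo_zero_one_subset_iUnion_dyadic).trans
            ((lintegral_iUnion_le _ _).trans (ENNReal.tsum_le_tsum hblock))
      _ = _ := by
          rw [ENNReal.tsum_mul_left, ENNReal.mul_rpow_of_nonneg _ _ (by positivity),
            ← ENNReal.rpow_mul, mul_one_div_cancel hp.ne', ENNReal.rpow_one]

/-- Cauchy condensation: tails decrease, so the one at `2^j - 1` is at most those at all indices `k
< 2^j`, and for `q < ∞` it can be averaged over the upper half of these. -/
theorem eLpNorm_dyadic_seqTail_le {q : ℝ≥0∞} (hq : q ≠ 0) (α : ℝ) {ι : Type*} (c : ι → ℂ) :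
    eLpNorm (fun j : ℕ => logWeight α j * seqTail c (2 ^ j - 1)) q Measure.count ≤
      (2 : ℝ≥0∞) ^ (|α| + (q⁻¹).toReal) * normlR q α c := by
  have hpt : ∀ j k : ℕ, 2 ^ j ≤ 2 * (k + 1) → k + 1 ≤ 2 ^ j →
      logWeight α j * seqTail c (2 ^ j - 1) ≤ (2 : ℝ≥0∞) ^ ((j : ℝ) * (q⁻¹).toReal) *
        ((2 : ℝ≥0∞) ^ |α| * tailTerm q α c k) := by
    intro j k h1 h2
    refine (mul_le_mul' (logWeight_le_mul_weight q α h1 h2)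
      (seqTail_antitone c (Nat.le_sub_one_of_lt h2))).trans_eq ?_
    rw [tailTerm, seqTail]; ring
  unfold normlR
  by_cases hq' : q = ∞
  · subst hq'
    rw [eLpNorm_top_count_eq_iSup, eLpNorm_top_count_eq_iSup]
    refine iSup_le fun j => ?_
    have hj := Nat.one_le_two_pow (n := j)
    refine (hpt j (2 ^ j - 1) (by omega) (by omega)).trans ?_
    simp only [ENNReal.inv_top, ENNReal.toReal_zero, mul_zero, ENNReal.rpow_zero, one_mul,
      add_zero]
    gcongr
    exact le_iSup (tailTerm ∞ α c) _
  · have hp := ENNReal.toReal_pos hq hq'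
    rw [eLpNorm_count_eq_tsum hq hq', eLpNorm_count_eq_tsum hq hq']
    set b : ℕ → ℝ≥0∞ := fun j => (logWeight α j * seqTail c (2 ^ j - 1)) ^ q.toReal with hb
    set D : ℝ≥0∞ := ((2 : ℝ≥0∞) ^ |α|) ^ q.toReal with hD
    have hpt' : ∀ j k : ℕ, 2 ^ j ≤ 2 * (k + 1) → k + 1 ≤ 2 ^ j →
        b j ≤ 2 ^ j * (D * tailTerm q α c k ^ q.toReal) := by
      intro j k h1 h2
      refine (ENNReal.rpow_le_rpow (hpt j k h1 h2) hp.le).trans_eq ?_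
      rw [ENNReal.mul_rpow_of_nonneg _ _ hp.le, rpow_mul_toReal_inv_rpow hq hq',
        ENNReal.mul_rpow_of_nonneg _ _ hp.le, ENNReal.rpow_natCast]
    -- Averaging over the `2^J` indices in `[2^J, 2^{J+1})` leaves `2^{J+1} / 2^J = 2`, the source
    -- of the factor `2^{1/q}`.
    have hstep : ∀ J : ℕ, b (J + 1) ≤
        2 * D * ∑ i ∈ Finset.range (2 ^ J), tailTerm q α c (2 ^ J + i) ^ q.toReal := by
      intro J
      have h1 : (2 : ℝ≥0∞) ^ J * b (J + 1) ≤ 2 ^ J *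
          (2 * D * ∑ i ∈ Finset.range (2 ^ J), tailTerm q α c (2 ^ J + i) ^ q.toReal) := by
        calc (2 : ℝ≥0∞) ^ J * b (J + 1) = ∑ i ∈ Finset.range (2 ^ J), b (J + 1) := by simp
          _ ≤ ∑ i ∈ Finset.range (2 ^ J),
              2 ^ (J + 1) * (D * tailTerm q α c (2 ^ J + i) ^ q.toReal) := by
            refine Finset.sum_le_sum fun i hi => hpt' _ _ ?_ ?_
            · rw [pow_succ]; omega
            · have := Finset.mem_range.1 hi
              rw [pow_succ]; omega
          _ = _ := by
            rw [← Finset.mul_sum, ← Finset.mul_sum, pow_succ]; ring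
      exact (ENNReal.mul_le_mul_iff_right (by simp) (by simp)).1 h1
    have hsum : ∀ J : ℕ, ∑ j ∈ Finset.range (J + 1), b j ≤
        2 * D * ∑ k ∈ Finset.range (2 ^ J), tailTerm q α c k ^ q.toReal := by
      intro J
      induction J with
      | zero =>
        have := hpt' 0 0 (by norm_num) (by norm_num)
        simp only [pow_zero, one_mul, zero_add, Finset.range_one, Finset.sum_singleton] at this ⊢
        refine this.trans ?_
        rw [mul_assoc]
        exact le_mul_of_one_le_left zero_le (by norm_num)
      | succ J ih =>
        rw [Finset.sum_range_succ, pow_succ, mul_two, Finset.sum_range_add _ (2 ^ J), mul_add]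
        exact add_le_add ih (hstep J)
    have htsum : ∑' j, b j ≤ 2 * D * ∑' k, tailTerm q α c k ^ q.toReal := by
      refine ENNReal.tsum_le_of_sum_range_le fun J => ?_
      refine (Finset.sum_le_sum_of_subset (Finset.range_mono J.le_succ)).trans ((hsum J).trans ?_)
      gcongr
      exact ENNReal.sum_le_tsum _
    refine (ENNReal.rpow_le_rpow htsum (by positivity)).trans_eq ?_
    rw [ENNReal.mul_rpow_of_nonneg _ _ (by positivity),
      ENNReal.mul_rpow_of_nonneg _ _ (by positivity), hD,
      ← ENNReal.rpow_mul _ q.toReal, mul_one_div_cancel hp.ne', ENNReal.rpow_one,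
      ENNReal.rpow_add _ _ two_ne_zero ENNReal.ofNat_ne_top, ENNReal.toReal_inv, one_div,
      mul_comm ((2 : ℝ≥0∞) ^ (q.toReal⁻¹))]

/-! ### A weighted Hardy-type inequality for sequences -/

/-- Each `y i` is at most the `l_r` quasi-norm of `y` on `s`. Being cruder than Hölder, this treats
`r < 1` and `r ≥ 1` alike. -/
theorem sum_mul_rpow_le {r : ℝ} (hr : 0 < r) (w y : ℕ → ℝ≥0∞) (s : Finset ℕ) :
    (∑ i ∈ s, w i * y i) ^ r ≤ (∑' i, w i) ^ r * ∑ i ∈ s, y i ^ r := by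
  have hy : ∀ i ∈ s, y i ≤ (∑ i ∈ s, y i ^ r) ^ (1 / r) := by
    intro i hi
    rw [← ENNReal.rpow_le_rpow_iff hr, ← ENNReal.rpow_mul, one_div_mul_cancel hr.ne',
      ENNReal.rpow_one]
    exact Finset.single_le_sum (f := fun i => y i ^ r) (fun _ _ => zero_le) hi
  calc (∑ i ∈ s, w i * y i) ^ r ≤ ((∑' i, w i) * (∑ i ∈ s, y i ^ r) ^ (1 / r)) ^ r := by
        refine ENNReal.rpow_le_rpow ?_ hr.le
        calc ∑ i ∈ s, w i * y i ≤ ∑ i ∈ s, w i * (∑ i ∈ s, y i ^ r) ^ (1 / r) :=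
              Finset.sum_le_sum fun i hi => mul_le_mul' le_rfl (hy i hi)
          _ = (∑ i ∈ s, w i) * (∑ i ∈ s, y i ^ r) ^ (1 / r) := by rw [Finset.sum_mul]
          _ ≤ _ := mul_le_mul' (ENNReal.sum_le_tsum _) le_rfl
    _ = _ := by
        rw [ENNReal.mul_rpow_of_nonneg _ _ hr.le, ← ENNReal.rpow_mul, one_div_mul_cancel hr.ne',
          ENNReal.rpow_one]

theorem tsum_sum_range_mul_le (u v : ℕ → ℝ≥0∞) :
    ∑' m, ∑ i ∈ Finset.range (m + 1), u i * v (m - i) ≤ (∑' i, u i) * ∑' j, v j := by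
  have h1 : ∀ m, ∑ i ∈ Finset.range (m + 1), u i * v (m - i) ≤
      ∑' i, u i * (if i ≤ m then v (m - i) else 0) := by
    intro m
    refine le_trans (Finset.sum_le_sum fun i hi => ?_) (ENNReal.sum_le_tsum (Finset.range (m + 1)))
    rw [if_pos (Nat.lt_succ_iff.1 (Finset.mem_range.1 hi))]
  refine (ENNReal.tsum_le_tsum h1).trans ?_
  rw [ENNReal.tsum_comm, ← ENNReal.tsum_mul_right]
  refine ENNReal.tsum_le_tsum fun i => ?_
  rw [ENNReal.tsum_mul_left]
  refine mul_le_mul' le_rfl (le_of_eq ?_)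
  rw [← Summable.sum_add_tsum_nat_add' (k := i) ENNReal.summable]
  have h0 : ∑ m ∈ Finset.range i, (if i ≤ m then v (m - i) else 0) = 0 :=
    Finset.sum_eq_zero fun m hm => if_neg (not_le.2 (Finset.mem_range.1 hm))
  simp [h0]

theorem tsum_two_rpow_mul_logWeight_ne_top {δ : ℝ} (hδ : 0 < δ) {β : ℝ} :
    ∑' i : ℕ, (2 : ℝ≥0∞) ^ (-(i : ℝ) * δ) * logWeight β i ≠ ∞ := by
  set r : ℝ := 2 ^ (-δ) with hr
  have hr0 : 0 < r := by positivity
  have hr1 : r < 1 := Real.rpow_lt_one_of_one_lt_of_neg (by norm_num) (by linarith)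
  obtain ⟨N, hN⟩ := exists_nat_ge β
  have hs : Summable fun i : ℕ => r⁻¹ * (((i + 1 : ℕ) : ℝ) ^ N * r ^ (i + 1)) := by
    refine Summable.mul_left _ ((summable_nat_add_iff
      (f := fun i : ℕ => (i : ℝ) ^ N * r ^ i) 1).2 ?_)
    exact summable_pow_mul_geometric_of_norm_lt_one N
      (by rwa [Real.norm_eq_abs, abs_of_pos hr0])
  refine ne_top_of_le_ne_top hs.tsum_ofReal_ne_top (ENNReal.tsum_le_tsum fun i => ?_)
  rw [logWeight, ← ofReal_two_rpow, ← ENNReal.ofReal_mul (by positivity)]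
  refine ENNReal.ofReal_le_ofReal ?_
  have h1 : (2 : ℝ) ^ (-(i : ℝ) * δ) = r ^ i := by
    rw [hr, ← Real.rpow_natCast, ← Real.rpow_mul (by norm_num)]; congr 1; ring
  have h2 : (1 + (i : ℝ)) ^ β ≤ ((i + 1 : ℕ) : ℝ) ^ N := by
    rw [← Real.rpow_natCast, add_comm]
    push_cast
    exact Real.rpow_le_rpow_of_exponent_le (by simp) hN
  rw [h1, pow_succ]
  calc r ^ i * (1 + (i : ℝ)) ^ β ≤ r ^ i * ((i + 1 : ℕ) : ℝ) ^ N := by gcongr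
    _ = _ := by field_simp

/-- Moving the weight from `m` to `m - i` costs `(1+i)^{|α|}`, which the kernel absorbs. The
constant does not depend on `l`; that dependence sits wholly in the factor `logWeight`. -/
theorem eLpNorm_logWeight_mul_le_of_le_convolution {q : ℝ≥0∞} (hq : q ≠ 0) (α : ℝ) :
    ∃ C : ℝ≥0∞, C ≠ ∞ ∧ ∀ (a F : ℕ → ℝ≥0∞) (l : ℕ), (∀ n, F n ≤ a 0) →
      (∀ m, F (m + l) ≤ ∑ i ∈ Finset.range (m + 1), (2 : ℝ≥0∞) ^ (-(i : ℝ) / 2) * a (m - i)) →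
      eLpNorm (fun n => logWeight α n * F n) q Measure.count ≤
        C * logWeight (|α| + (q⁻¹).toReal) l *
          eLpNorm (fun n => logWeight α n * a n) q Measure.count := by
  -- The kernel `2^{-i/2}` is split into two factors `2^{-i/4}`: `w` absorbs the weight and is
  -- summed inside the power, while `z` keeps the decay needed to sum after taking powers.
  set w : ℕ → ℝ≥0∞ := fun i => (2 : ℝ≥0∞) ^ (-(i : ℝ) * (1 / 4)) * logWeight |α| i with hw
  set z : ℕ → ℝ≥0∞ := fun i => (2 : ℝ≥0∞) ^ (-(i : ℝ) * (1 / 4)) with hz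
  have hA : ∑' i, w i ≠ ∞ := tsum_two_rpow_mul_logWeight_ne_top (by norm_num)
  have hw0 : 1 ≤ ∑' i, w i := by
    have := ENNReal.le_tsum (f := w) 0
    simpa [hw] using this
  have hz1 : ∀ i, z i ≤ 1 := by
    intro i
    refine (ENNReal.rpow_le_rpow_of_exponent_le (by norm_num)
      (show -(i : ℝ) * (1 / 4) ≤ 0 from ?_)).trans_eq (by simp)
    have := Nat.cast_nonneg (α := ℝ) i
    linarith
  have hpt : ∀ (a F : ℕ → ℝ≥0∞) (l : ℕ),
      (∀ m, F (m + l) ≤ ∑ i ∈ Finset.range (m + 1), (2 : ℝ≥0∞) ^ (-(i : ℝ) / 2) * a (m - i)) →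
      ∀ m, logWeight α (m + l) * F (m + l) ≤ logWeight |α| l *
        ∑ i ∈ Finset.range (m + 1), w i * (z i * (logWeight α (m - i) * a (m - i))) := by
    intro a F l h m
    refine (mul_le_mul' (logWeight_add_le α m l) (h m)).trans ?_
    rw [mul_assoc, Finset.mul_sum]
    refine mul_le_mul' le_rfl (Finset.sum_le_sum fun i hi => ?_)
    have him : i ≤ m := Nat.lt_succ_iff.1 (Finset.mem_range.1 hi)
    have h1 : logWeight α m ≤ logWeight |α| i * logWeight α (m - i) := by
      have := logWeight_add_le α (m - i) i
      rwa [Nat.sub_add_cancel him] at this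
    have h2 : (2 : ℝ≥0∞) ^ (-(i : ℝ) / 2) = z i * z i := by
      rw [hz, ← ENNReal.rpow_add _ _ two_ne_zero ENNReal.ofNat_ne_top]
      congr 1; ring
    refine (mul_le_mul' h1 le_rfl).trans_eq ?_
    rw [h2, hw, hz]
    ring
  by_cases hq' : q = ∞
  · subst hq'
    refine ⟨∑' i, w i, hA, fun a F l h0 h => ?_⟩
    rw [eLpNorm_top_count_eq_iSup, eLpNorm_top_count_eq_iSup]
    set B := ⨆ n, logWeight α n * a n with hB
    have hBn : ∀ n, logWeight α n * a n ≤ B := le_iSup fun n => logWeight α n * a n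
    simp only [ENNReal.inv_top, ENNReal.toReal_zero, add_zero]
    refine iSup_le fun n => ?_
    rcases lt_or_ge n l with hn | hn
    · calc logWeight α n * F n ≤ logWeight |α| l * (logWeight α 0 * a 0) := by
            rw [logWeight_zero, one_mul]
            exact mul_le_mul' (logWeight_le_of_le hn.le) (h0 n)
        _ ≤ logWeight |α| l * B := mul_le_mul' le_rfl (hBn 0)
        _ ≤ _ := by
            rw [mul_assoc]
            exact le_mul_of_one_le_left zero_le hw0
    · obtain ⟨m, rfl⟩ := Nat.exists_eq_add_of_le' hn
      refine (hpt a F l h m).trans ?_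
      calc _ ≤ logWeight |α| l * ∑ i ∈ Finset.range (m + 1), w i * (1 * B) := by
            gcongr with i hi
            · exact hz1 i
            · exact hBn _
        _ = logWeight |α| l * ((∑ i ∈ Finset.range (m + 1), w i) * B) := by
            rw [Finset.sum_mul]; simp
        _ ≤ logWeight |α| l * ((∑' i, w i) * B) := by
            gcongr
            exact ENNReal.sum_le_tsum _
        _ = _ := by ring
  · have hp := ENNReal.toReal_pos hq hq'
    set r := q.toReal with hr
    have hZ : ∑' i, z i ^ r ≠ ∞ := by
      have := tsum_two_rpow_mul_logWeight_ne_top (δ := 1 / 4 * r) (by positivity) (β := 0)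
      convert this using 3 with i
      rw [hz, ← ENNReal.rpow_mul, mul_assoc]
      simp [logWeight]
    -- The summand `1` pays for the first `l` terms, the other for the convolution.
    set D : ℝ≥0∞ := 1 + (∑' i, w i) ^ r * ∑' i, z i ^ r with hD
    have hDt : D ≠ ∞ :=
      ENNReal.add_ne_top.2 ⟨by simp, ENNReal.mul_ne_top (ENNReal.rpow_ne_top_of_nonneg hp.le hA) hZ⟩
    refine ⟨D ^ (1 / r), ENNReal.rpow_ne_top_of_nonneg (by positivity) hDt,
      fun a F l h0 h => ?_⟩
    rw [eLpNorm_count_eq_tsum hq hq', eLpNorm_count_eq_tsum hq hq', ← hr]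
    set B := ∑' n, (logWeight α n * a n) ^ r with hB
    have hhead : ∑ n ∈ Finset.range l, (logWeight α n * F n) ^ r ≤
        l * (logWeight |α| l ^ r * B) := by
      calc _ ≤ ∑ n ∈ Finset.range l, logWeight |α| l ^ r * B := by
            refine Finset.sum_le_sum fun n hn => ?_
            have h1 : a 0 ^ r ≤ B := by
              have := ENNReal.le_tsum (f := fun n => (logWeight α n * a n) ^ r) 0
              simpa using this
            rw [ENNReal.mul_rpow_of_nonneg _ _ hp.le]
            exact mul_le_mul' (ENNReal.rpow_le_rpow
              (logWeight_le_of_le (Finset.mem_range.1 hn).le) hp.le)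
              ((ENNReal.rpow_le_rpow (h0 n) hp.le).trans h1)
        _ = _ := by simp
    have htail : ∑' m, (logWeight α (m + l) * F (m + l)) ^ r ≤
        logWeight |α| l ^ r * ((∑' i, w i) ^ r * (∑' i, z i ^ r) * B) := by
      calc _ ≤ ∑' m, logWeight |α| l ^ r * ((∑' i, w i) ^ r *
            ∑ i ∈ Finset.range (m + 1), z i ^ r * (logWeight α (m - i) * a (m - i)) ^ r) := by
            refine ENNReal.tsum_le_tsum fun m => ?_
            refine (ENNReal.rpow_le_rpow (hpt a F l h m) hp.le).trans ?_
            rw [ENNReal.mul_rpow_of_nonneg _ _ hp.le]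
            refine mul_le_mul' le_rfl ((sum_mul_rpow_le hp w _ _).trans_eq ?_)
            simp only [ENNReal.mul_rpow_of_nonneg _ _ hp.le]
        _ ≤ _ := by
            rw [ENNReal.tsum_mul_left, ENNReal.tsum_mul_left, mul_assoc]
            gcongr
            exact tsum_sum_range_mul_le (fun i => z i ^ r) fun j => (logWeight α j * a j) ^ r
    have hL : logWeight (|α| + (q⁻¹).toReal) l =
        (((1 + l : ℕ) : ℝ≥0∞) * logWeight |α| l ^ r) ^ (1 / r) := by
      rw [ENNReal.mul_rpow_of_nonneg _ _ (by positivity), ← ENNReal.rpow_mul,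
        mul_one_div_cancel hp.ne', ENNReal.rpow_one, logWeight, logWeight,
        Real.rpow_add (by positivity), ENNReal.ofReal_mul (by positivity), mul_comm,
        ENNReal.toReal_inv, ← hr, one_div, ← ENNReal.ofReal_rpow_of_pos (by positivity)]
      congr 2
      rw [← ENNReal.ofReal_natCast]
      push_cast; rfl
    have htotal : ∑' n, (logWeight α n * F n) ^ r ≤
        D * (((1 + l : ℕ) : ℝ≥0∞) * logWeight |α| l ^ r) * B := by
      rw [← Summable.sum_add_tsum_nat_add' (k := l) ENNReal.summable]
      refine (add_le_add hhead htail).trans ?_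
      set X := (∑' i, w i) ^ r * (∑' i, z i ^ r)
      have h1 : (l : ℝ≥0∞) * (logWeight |α| l ^ r * B) ≤
          1 * (((1 + l : ℕ) : ℝ≥0∞) * (logWeight |α| l ^ r * B)) := by
        rw [one_mul]; gcongr; simp
      have h2 : logWeight |α| l ^ r * (X * B) ≤
          X * (((1 + l : ℕ) : ℝ≥0∞) * (logWeight |α| l ^ r * B)) := by
        calc _ = X * (1 * (logWeight |α| l ^ r * B)) := by ring
          _ ≤ _ := by gcongr; simp
      refine (add_le_add h1 h2).trans_eq ?_
      rw [hD]; ring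
    refine (ENNReal.rpow_le_rpow htotal (by positivity)).trans_eq ?_
    rw [hL, ENNReal.mul_rpow_of_nonneg _ _ (by positivity),
      ENNReal.mul_rpow_of_nonneg _ _ (by positivity)]

/-! ### The constant -/

/-- The choice `l = ⌈2 log_2 M⌉` gives `1 + l ≤ 3(1 + log M)`, because `2 / log 2 < 3`. It remains
to dominate `(1 + log M)^a` by each member of the minimum. -/
theorem exists_const_one_add_log (a ε : ℝ) (ha : 0 ≤ a) (hε : 0 ≤ ε) :
    ∃ K : ℝ, 0 ≤ K ∧ ∀ M : ℝ, 1 ≤ M → ∃ l : ℕ, M ≤ 2 ^ ((l : ℝ) / 2) ∧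
      (1 + (l : ℝ)) ^ a ≤ K * min M ((1 + Real.log M) ^ (a + ε)) := by
  have hone : (1 : ℝ) ≤ (a + 1) ^ (a + 1) := Real.one_le_rpow (by linarith) (by linarith)
  refine ⟨3 ^ a * (a + 1) ^ (a + 1), by positivity, fun M hM => ?_⟩
  have hM0 : 0 < M := by linarith
  have hlM : 0 ≤ Real.log M := Real.log_nonneg hM
  have hlog1 := Real.log_two_gt_d9
  have hlog0 : 0 < Real.log 2 := by linarith
  refine ⟨⌈2 * Real.log M / Real.log 2⌉₊, ?_, ?_⟩
  · have h := Nat.le_ceil (2 * Real.log M / Real.log 2)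
    rw [← Real.log_le_log_iff hM0 (by positivity), Real.log_rpow (by norm_num)]
    rw [div_le_iff₀ hlog0] at h
    linarith
  · have h := Nat.ceil_lt_add_one (a := 2 * Real.log M / Real.log 2) (by positivity)
    set l := ⌈2 * Real.log M / Real.log 2⌉₊
    have h3 : 2 * Real.log M / Real.log 2 ≤ 3 * Real.log M := by
      rw [div_le_iff₀ hlog0]; nlinarith
    have hl : 1 + (l : ℝ) ≤ 3 * (1 + Real.log M) := by linarith
    -- From `1 + x ≤ e^x` at `x = log M / (a+1)`, raised to the power `a + 1`; using `a + 1` avoids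
    -- dividing by zero when `a = 0`.
    have h4 : (1 + Real.log M) ^ a ≤ (a + 1) ^ (a + 1) * M := by
      calc (1 + Real.log M) ^ a ≤ (1 + Real.log M) ^ (a + 1) :=
            Real.rpow_le_rpow_of_exponent_le (by linarith) (by linarith)
        _ ≤ ((a + 1) * Real.exp (Real.log M / (a + 1))) ^ (a + 1) := by
            refine Real.rpow_le_rpow (by positivity) ?_ (by positivity)
            have := Real.add_one_le_exp (Real.log M / (a + 1))
            calc 1 + Real.log M ≤ (a + 1) * (Real.log M / (a + 1) + 1) := by
                  rw [mul_add, mul_div_cancel₀ _ (by positivity)]; linarith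
              _ ≤ _ := by gcongr
        _ = _ := by
            rw [Real.mul_rpow (by positivity) (by positivity), ← Real.exp_mul,
              div_mul_cancel₀ _ (by positivity), Real.exp_log hM0]
    have h5 : (1 + Real.log M) ^ a ≤ (a + 1) ^ (a + 1) * (1 + Real.log M) ^ (a + ε) := by
      refine (Real.rpow_le_rpow_of_exponent_le (by linarith) (by linarith)).trans
        (le_mul_of_one_le_left (by positivity) hone)
    calc (1 + (l : ℝ)) ^ a ≤ (3 * (1 + Real.log M)) ^ a :=
          Real.rpow_le_rpow (by positivity) hl ha
      _ = 3 ^ a * (1 + Real.log M) ^ a := Real.mul_rpow (by norm_num) (by positivity)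
      _ ≤ 3 ^ a * ((a + 1) ^ (a + 1) * min M ((1 + Real.log M) ^ (a + ε))) := by
          gcongr
          rw [mul_min_of_nonneg _ _ (by positivity)]
          exact le_min h4 h5
      _ = _ := by ring

/-! ### The norm inequality -/

theorem seqTail_zero_le_normlR {q : ℝ≥0∞} (hq : q ≠ 0) (α : ℝ) {ι : Type*} (c : ι → ℂ) :
    seqTail c 0 ≤ normlR q α c := by
  have h := enorm_le_eLpNorm_count (tailTerm q α c) 0 hq
  have h1 : weight q α 1 = 1 := by simp [weight]
  simpa [tailTerm, h1, seqTail, normlR] using h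

theorem exists_normLL_le_mul_normlR {q : ℝ≥0∞} (hq : q ≠ 0) (α : ℝ) :
    ∃ C : ℝ≥0∞, C ≠ ∞ ∧ ∀ (ι : Type) [Countable ι] (φ : ι → Lp ℂ 2 unitMeasure) (M : ℝ≥0∞) (l : ℕ),
      Orthonormal ℂ φ → (∀ n, eLpNorm (φ n) ∞ unitMeasure ≤ M) →
      M ≤ (2 : ℝ≥0∞) ^ ((l : ℝ) / 2) → ∀ c : ι → ℂ, normlR q α c ≠ ∞ →
      ∀ f : Lp ℂ 2 unitMeasure, HasSum (fun n => c n • φ n) f →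
        normLL q α f ≤ C * logWeight (|α| + (q⁻¹).toReal) l * normlR q α c := by
  obtain ⟨C, hC, hmain⟩ := eLpNorm_logWeight_mul_le_of_le_convolution hq α
  refine ⟨(2 : ℝ≥0∞) ^ |α| * C * (2 : ℝ≥0∞) ^ (|α| + (q⁻¹).toReal), ?_, ?_⟩
  · refine ENNReal.mul_ne_top (ENNReal.mul_ne_top ?_ hC) ?_ <;>
      exact ENNReal.rpow_ne_top_of_nonneg (by positivity) ENNReal.ofNat_ne_top
  · intro ι _ φ M l hφ hM hl c hc f hf
    have hc0 : seqTail c 0 ≠ ∞ := ne_top_of_le_ne_top hc (seqTail_zero_le_normlR hq α c)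
    have h := hmain (fun j => seqTail c (2 ^ j - 1)) (fun n => funHead f ((2 : ℝ)⁻¹ ^ n)) l
      (fun n => by simpa using funHead_le_seqTail_zero hφ hM hc0 hf _)
      (fun m => funHead_dyadic_le hφ hM hc0 hf hl m)
    calc normLL q α f ≤ _ := normLL_le_dyadic hq α f
      _ ≤ (2 : ℝ≥0∞) ^ |α| * (C * logWeight (|α| + (q⁻¹).toReal) l *
          ((2 : ℝ≥0∞) ^ (|α| + (q⁻¹).toReal) * normlR q α c)) :=
        mul_le_mul' le_rfl (h.trans (mul_le_mul' le_rfl (eLpNorm_dyadic_seqTail_le hq α c)))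
      _ = _ := by ring

/-! ### Convergence of the remainders -/

theorem enorm_ite_le {ι : Type*} [DecidableEq ι] (c : ι → ℂ) (F : Finset ι) (i : ι) :
    ‖(if i ∈ F then 0 else c i : ℂ)‖ₑ ≤ ‖c i‖ₑ := by
  split_ifs <;> simp

theorem tailTerm_mono {ι : Type*} {c d : ι → ℂ} (h : ∀ i, ‖d i‖ₑ ≤ ‖c i‖ₑ) (q : ℝ≥0∞) (α : ℝ)
    (k : ℕ) :
    tailTerm q α d k ≤ tailTerm q α c k := by
  refine mul_le_mul' le_rfl (ENNReal.rpow_le_rpow (ENNReal.tsum_le_tsum fun i => ?_) (by norm_num))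
  exact pow_le_pow_left' (seqRearr_mono h _) 2

/-- Only finitely many coefficients exceed a given level, so the supremum off `F`, and with it every
rearranged term, tends to zero. Dominated convergence with majorant `(c*_k)^2` does the rest. -/
theorem tendsto_seqTail_remainder {ι : Type*} [DecidableEq ι] [Countable ι] {c : ι → ℂ}
    (hc : seqTail c 0 ≠ ∞) :
    Tendsto (fun F : Finset ι => seqTail (fun i => if i ∈ F then 0 else c i) 0) atTop (𝓝 0) := by
  have hc' := tsum_ne_top_of_seqTail_zero_ne_top hc
  have hsup : Tendsto (fun F : Finset ι => ⨆ i, ‖(if i ∈ F then 0 else c i : ℂ)‖ₑ) atTop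
      (𝓝 0) := by
    rw [ENNReal.tendsto_nhds_zero]
    intro ε hε
    have hfin := finite_lt_enorm_of_tsum_seqRearr_ne_top hc' hε
    filter_upwards [eventually_ge_atTop hfin.toFinset] with F hF
    refine iSup_le fun i => ?_
    split_ifs with hi
    · simp
    · by_contra! hlt
      exact hi (hF (hfin.mem_toFinset.2 hlt))
  have hterm : ∀ k, Tendsto (fun F : Finset ι =>
      seqRearr (fun i => if i ∈ F then 0 else c i) k ^ 2) atTop (𝓝 0) := by
    intro k
    have h1 : Tendsto (fun F : Finset ι => seqRearr (fun i => if i ∈ F then 0 else c i) k) atTop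
        (𝓝 0) :=
      tendsto_of_tendsto_of_tendsto_of_le_of_le tendsto_const_nhds hsup (fun _ => zero_le)
        fun F => seqRearr_le_iSup _ k
    have h2 := ((ENNReal.continuous_pow 2).tendsto 0).comp h1
    rwa [zero_pow two_ne_zero] at h2
  have hsum : Tendsto (fun F : Finset ι =>
      ∑' k, seqRearr (fun i => if i ∈ F then 0 else c i) k ^ 2) atTop (𝓝 0) := by
    have := tendsto_lintegral_filter_of_dominated_convergence (μ := Measure.count)
      (l := (atTop : Filter (Finset ι))) (f := fun _ : ℕ => (0 : ℝ≥0∞))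
      (F := fun F k => seqRearr (fun i => if i ∈ F then 0 else c i) k ^ 2)
      (fun k => seqRearr c k ^ 2) (.of_forall fun _ => measurable_of_countable _)
      (.of_forall fun F => .of_forall fun k =>
        pow_le_pow_left' (seqRearr_mono (enorm_ite_le c F) k) 2)
      (by rwa [lintegral_count]) (.of_forall hterm)
    simpa [lintegral_count] using this
  have := ((ENNReal.continuous_rpow_const (y := 1 / 2)).tendsto 0).comp hsum
  rw [ENNReal.zero_rpow_of_pos (by norm_num)] at this
  simpa only [seqTail, zero_add, Function.comp_def] using this

theorem tendsto_normlR_remainder {ι : Type*} [DecidableEq ι] [Countable ι] {q : ℝ≥0∞}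
    (hq : q ≠ 0) {α : ℝ} {c : ι → ℂ} (hc : normlR q α c ≠ ∞)
    (hlim : q ≠ ∞ ∨ Tendsto (tailTerm q α c) atTop (𝓝 0)) :
    Tendsto (fun F : Finset ι => normlR q α fun i => if i ∈ F then 0 else c i) atTop (𝓝 0) := by
  have hc0 : seqTail c 0 ≠ ∞ := ne_top_of_le_ne_top hc (seqTail_zero_le_normlR hq α c)
  have hterm : ∀ k, Tendsto (fun F : Finset ι =>
      tailTerm q α (fun i => if i ∈ F then 0 else c i) k) atTop (𝓝 0) := by
    intro k
    have h1 := ENNReal.Tendsto.const_mul (a := weight q α ((k : ℝ) + 1))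
      (tendsto_seqTail_remainder hc0) (.inr ENNReal.ofReal_ne_top)
    rw [mul_zero] at h1
    exact tendsto_of_tendsto_of_tendsto_of_le_of_le tendsto_const_nhds h1 (fun _ => zero_le)
      fun F => mul_le_mul' le_rfl (seqTail_antitone _ (Nat.zero_le k))
  by_cases hq' : q = ∞
  · subst hq'
    have hlim' := hlim.resolve_left (by simp)
    simp only [normlR, eLpNorm_top_count_eq_iSup]
    rw [ENNReal.tendsto_nhds_zero] at hlim' ⊢
    intro ε hε
    -- A supremum has no dominated convergence: the decay hypothesis controls `k ≥ K` uniformly in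
    -- `F`, and termwise convergence handles the finitely many `k < K`.
    obtain ⟨K, hK⟩ := eventually_atTop.1 (hlim' ε hε)
    have hfin : ∀ᶠ F : Finset ι in atTop, ∀ k ∈ Finset.range K,
        tailTerm ∞ α (fun i => if i ∈ F then 0 else c i) k ≤ ε :=
      (eventually_all_finset _).2 fun k _ => ENNReal.tendsto_nhds_zero.1 (hterm k) ε hε
    filter_upwards [hfin] with F hF
    refine iSup_le fun k => ?_
    rcases lt_or_ge k K with hk | hk
    · exact hF k (Finset.mem_range.2 hk)
    · exact (tailTerm_mono (enorm_ite_le c F) _ _ k).trans (hK k hk)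
  · have hp := ENNReal.toReal_pos hq hq'
    have hfin : ∑' k, tailTerm q α c k ^ q.toReal ≠ ∞ := by
      intro h
      refine hc ?_
      rw [normlR, eLpNorm_count_eq_tsum hq hq', h]
      exact ENNReal.top_rpow_of_pos (by positivity)
    simp only [normlR, eLpNorm_count_eq_tsum hq hq']
    have hsum : Tendsto (fun F : Finset ι =>
        ∑' k, tailTerm q α (fun i => if i ∈ F then 0 else c i) k ^ q.toReal) atTop (𝓝 0) := by
      have := tendsto_lintegral_filter_of_dominated_convergence (μ := Measure.count)
        (l := (atTop : Filter (Finset ι))) (f := fun _ : ℕ => (0 : ℝ≥0∞))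
        (F := fun F k => tailTerm q α (fun i => if i ∈ F then 0 else c i) k ^ q.toReal)
        (fun k => tailTerm q α c k ^ q.toReal) (.of_forall fun _ => measurable_of_countable _)
        (.of_forall fun F => .of_forall fun k =>
          ENNReal.rpow_le_rpow (tailTerm_mono (enorm_ite_le c F) _ _ k) hp.le)
        (by rwa [lintegral_count]) (.of_forall fun k => by
          have := ((ENNReal.continuous_rpow_const (y := q.toReal)).tendsto 0).comp (hterm k)
          rwa [ENNReal.zero_rpow_of_pos hp] at this)
      simpa [lintegral_count] using this
    have := ((ENNReal.continuous_rpow_const (y := 1 / q.toReal)).tendsto 0).comp hsum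
    rwa [ENNReal.zero_rpow_of_pos (by positivity)] at this

/-- On a probability space the `L_2` norm, here `1`, is at most the `L_∞` norm. -/
theorem one_le_iSup_eLpNorm_top {ι : Type*} [Nonempty ι] {φ : ι → Lp ℂ 2 unitMeasure}
    (hφ : Orthonormal ℂ φ) : 1 ≤ ⨆ n, eLpNorm (φ n) ∞ unitMeasure := by
  have : IsProbabilityMeasure unitMeasure := ⟨by simp⟩
  obtain ⟨n⟩ := ‹Nonempty ι›
  refine le_trans ?_ (le_iSup (fun n => eLpNorm (φ n) ∞ unitMeasure) n)
  have h1 : eLpNorm (φ n) 2 unitMeasure = 1 := by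
    rw [← Lp.enorm_def, ← ofReal_norm, hφ.1 n, ENNReal.ofReal_one]
  rw [← h1]
  exact eLpNorm_le_eLpNorm_of_exponent_le le_top (Lp.aestronglyMeasurable _)

end LimitingFourier

open LimitingFourier

theorem theorem1p2 (q : ℝ≥0∞) (hq : q ≠ 0) (α : ℝ) (hα : -(q⁻¹).toReal < α)
    (ε : ℝ) (hε : 0 < ε) :
    ∃ C : ℝ≥0, ∀ (ι : Type) [Countable ι] [Nonempty ι]
      (φ : ι → Lp ℂ 2 LimitingFourier.unitMeasure) (M : ℝ≥0),
      Orthonormal ℂ φ →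
      (⨆ n, eLpNorm (φ n) ∞ LimitingFourier.unitMeasure) = (M : ℝ≥0∞) →
      ∀ c : ι → ℂ, LimitingFourier.normlR q α c < ∞ →
        ∃ f : Lp ℂ 2 LimitingFourier.unitMeasure,
          HasSum (fun n => c n • φ n) f ∧
          LimitingFourier.normLL q α f ≤
            C * ENNReal.ofReal
                (min (M : ℝ) ((1 + Real.log M) ^ (|α| + ε + (q⁻¹).toReal))) *
              LimitingFourier.normlR q α c ∧
          (q ≠ ∞ ∨ Tendsto (LimitingFourier.tailTerm q α c) atTop (𝓝 0) →
            Tendsto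
              (fun F : Finset ι => LimitingFourier.normLL q α
                (f - ∑ n ∈ F, c n • φ n : Lp ℂ 2 LimitingFourier.unitMeasure))
              atTop (𝓝 0)) := by
  classical
  obtain ⟨C, hC, hmain⟩ := exists_normLL_le_mul_normlR hq α
  obtain ⟨K, hK0, hK⟩ := exists_const_one_add_log (|α| + (q⁻¹).toReal) ε (by positivity) hε.le
  refine ⟨C.toNNReal * K.toNNReal, fun ι _ _ φ M hφ hM c hc => ?_⟩
  have hM1 : (1 : ℝ) ≤ M := by
    have := one_le_iSup_eLpNorm_top hφ
    rw [hM] at this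
    exact_mod_cast this
  have hMn : ∀ n, eLpNorm (φ n) ∞ unitMeasure ≤ M := fun n =>
    (le_iSup (fun n => eLpNorm (φ n) ∞ unitMeasure) n).trans_eq hM
  obtain ⟨l, hl, hlK⟩ := hK M hM1
  have hl' : (M : ℝ≥0∞) ≤ (2 : ℝ≥0∞) ^ ((l : ℝ) / 2) := by
    rw [← ofReal_two_rpow, ← ENNReal.ofReal_coe_nnreal]
    exact ENNReal.ofReal_le_ofReal hl
  have hbound := hmain ι φ M l hφ hMn hl'
  have hc0 : seqTail c 0 ≠ ∞ := ne_top_of_le_ne_top hc.ne (seqTail_zero_le_normlR hq α c)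
  have hc2 := tsum_ne_top_of_seqTail_zero_ne_top hc0
  obtain ⟨f, hf⟩ := summable_smul_of_orthonormal hφ
    (ne_top_of_le_ne_top hc2 (tsum_enorm_sq_le hc2))
  refine ⟨f, hf, (hbound c hc.ne f hf).trans ?_, fun hlim => ?_⟩
  · refine mul_le_mul' ?_ le_rfl
    rw [ENNReal.coe_mul, ENNReal.coe_toNNReal hC, mul_assoc]
    refine mul_le_mul' le_rfl ?_
    change _ ≤ ENNReal.ofReal K * _
    rw [← ENNReal.ofReal_mul hK0, logWeight]
    refine ENNReal.ofReal_le_ofReal ?_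
    rwa [show |α| + ε + (q⁻¹).toReal = |α| + (q⁻¹).toReal + ε by ring]
  -- The system is unchanged, so one `l` and one constant bound all remainders.
  · have hlimit := ENNReal.Tendsto.const_mul (a := C * logWeight (|α| + (q⁻¹).toReal) l)
      (tendsto_normlR_remainder hq hc.ne hlim)
      (.inr (ENNReal.mul_ne_top hC ENNReal.ofReal_ne_top))
    rw [mul_zero] at hlimit
    refine tendsto_of_tendsto_of_tendsto_of_le_of_le tendsto_const_nhds hlimit
      (fun _ => zero_le) fun F => hbound _ ?_ _ (hasSum_remainder hf F)
    refine ne_top_of_le_ne_top hc.ne (eLpNorm_mono_enorm fun k => ?_)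
    simpa using tailTerm_mono (enorm_ite_le c F) q α k
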